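/- For positive integers $s$ and $k$, let $r(s,k)$ denote the Ramsey number, i.e. the least integer $n$ such that every graph on $n$ vertices contains a clique of size $s$ or an independent set of size $k$. (1) For every real $\delta > 0$ there exists a constant $L$ such that for all positive integers $s \ge L$ and $k \ge Ls$, \[ r(s,k) \ge \left(\frac{k}{s}\right)^{(1-\delta)s}. \] (2) Consequently, if $s \to \infty$ and $k/s \to \infty$, then \[ r(s,k) = \left(\frac{k}{s}\right)^{(1+o(1))s}; \] that is, for all sequences $(s_n)$, $(k_n)$ of positive integers with $s_n \to \infty$ and $k_n/s_n \to \infty$ there are real numbers $\varepsilon_n \to 0$ such that $r(s_n,k_n) = (k_n/s_n)^{(1+\varepsilon_n)s_n}$ for all sufficiently large $n$. -/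

import Mathlib

/-- The Ramsey number `r(s, k)`: the least `n` such that every graph on `n` vertices contains a
clique of size `s` or an independent set of size `k`. -/
noncomputable def ramseyNumber (s k : ℕ) : ℕ :=
  sInf {n : ℕ | ∀ G : SimpleGraph (Fin n),
    (∃ t : Finset (Fin n), G.IsNClique s t) ∨ (∃ t : Finset (Fin n), G.IsNIndepSet k t)}

/-! The lower bound takes vertices that are random pairs `(a, b)` of vectors in `F_q ^ (s - 1)` with
`a ⬝ᵥ b ≠ 0`, and joins `i < j` when `a_i ⬝ᵥ b_j = 0`. A clique gives a triangular matrix with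
nonzero diagonal, so it has at most `s - 1` vertices (`card_le_of_triangular`). Independent `k`-sets
are excluded by a union bound that needs few sequences with no such orthogonality
(`card_unrelatedSeq_le`). Reading a sequence in order, track the set `S` of `b` still allowed:
either `a` is orthogonal to a `1/(2q)` share of `S`, which shrinks `S` and happens at most `T`
times, or `a` is one of the few exceptions allowed by pseudorandomness (`card_light_mul_card_le`).
With `q` slightly below `k/s`, `T` is a small fraction of `k`, and about `q ^ s` vertices survive.
The matching upper bound is Erdős–Szekeres. -/

open Finset

/-! ### Erdős–Szekeres and basic facts on Ramsey numbers. -/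

/-- The Erdős–Szekeres bound, inside a finite set of vertices. -/
lemma exists_isNClique_or_isNIndepSet_of_choose_le_card {V : Type*} (G : SimpleGraph V) (s k : ℕ) :
    ∀ U : Finset V, (s + k).choose s ≤ #U →
      (∃ t ⊆ U, G.IsNClique s t) ∨ (∃ t ⊆ U, G.IsNIndepSet k t) := by
  classical
  induction s generalizing k with
  | zero => exact fun U _ => .inl ⟨∅, empty_subset _, SimpleGraph.isNClique_empty.2 rfl⟩
  | succ s ihs =>
    induction k with
    | zero =>
      refine fun U _ => .inr ⟨∅, empty_subset _, ?_⟩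
      rw [← SimpleGraph.isNClique_compl]
      exact SimpleGraph.isNClique_empty.2 rfl
    | succ k ihk =>
      intro U hU
      have hpascal : (s + 1 + (k + 1)).choose (s + 1) =
          (s + (k + 1)).choose s + (s + 1 + k).choose (s + 1) := by
        rw [show s + 1 + (k + 1) = (s + (k + 1)) + 1 by ring, Nat.choose_succ_succ,
          show s + (k + 1) = s + 1 + k by ring]
      have hpos : 0 < (s + (k + 1)).choose s := Nat.choose_pos (by omega)
      obtain ⟨v, hv⟩ : U.Nonempty := card_pos.1 (by omega)
      have hcard : #((U.erase v).filter (G.Adj v)) + #((U.erase v).filter (¬ G.Adj v ·)) + 1 = #U := by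
        rw [card_filter_add_card_filter_not, card_erase_add_one hv]
      by_cases h : (s + (k + 1)).choose s ≤ #((U.erase v).filter (G.Adj v))
      · rcases ihs (k + 1) _ h with ⟨t, ht, hc⟩ | ⟨t, ht, hi⟩
        · refine .inl ⟨insert v t, ?_, ?_⟩
          · exact insert_subset hv fun x hx => mem_of_mem_erase (mem_filter.1 (ht hx)).1
          · exact hc.insert fun b hb => (mem_filter.1 (ht hb)).2
        · exact .inr ⟨t, fun x hx => mem_of_mem_erase (mem_filter.1 (ht hx)).1, hi⟩
      · rcases ihk ((U.erase v).filter (¬ G.Adj v ·)) (by omega) with ⟨t, ht, hc⟩ | ⟨t, ht, hi⟩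
        · exact .inl ⟨t, fun x hx => mem_of_mem_erase (mem_filter.1 (ht hx)).1, hc⟩
        · refine .inr ⟨insert v t, ?_, ?_⟩
          · exact insert_subset hv fun x hx => mem_of_mem_erase (mem_filter.1 (ht hx)).1
          · rw [← SimpleGraph.isNClique_compl] at hi ⊢
            refine hi.insert fun b hb => ?_
            have := mem_filter.1 (ht hb)
            rw [SimpleGraph.compl_adj]
            exact ⟨(ne_of_mem_erase this.1).symm, this.2⟩

lemma ramseyNumber_le_choose (s k : ℕ) : ramseyNumber s k ≤ (s + k).choose s := by
  refine Nat.sInf_le fun G => ?_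
  rcases exists_isNClique_or_isNIndepSet_of_choose_le_card G s k univ (by simp) with
    ⟨t, -, h⟩ | ⟨t, -, h⟩
  exacts [.inl ⟨t, h⟩, .inr ⟨t, h⟩]

lemma lt_ramseyNumber {s k N : ℕ} (G : SimpleGraph (Fin N)) (hs : ∀ t, ¬ G.IsNClique s t)
    (hk : ∀ t, ¬ G.IsNIndepSet k t) : N < ramseyNumber s k := by
  by_contra! hN
  have hmem : ramseyNumber s k ∈ {n : ℕ | ∀ G : SimpleGraph (Fin n),
      (∃ t : Finset (Fin n), G.IsNClique s t) ∨ (∃ t : Finset (Fin n), G.IsNIndepSet k t)} := by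
    -- Erdős–Szekeres makes the set nonempty, so its infimum is attained rather than the default
    -- `0`.
    refine Nat.sInf_mem ⟨(s + k).choose s, fun G => ?_⟩
    rcases exists_isNClique_or_isNIndepSet_of_choose_le_card G s k univ (by simp) with
      ⟨t, -, h⟩ | ⟨t, -, h⟩
    exacts [.inl ⟨t, h⟩, .inr ⟨t, h⟩]
  have e : G.comap (Fin.castLEEmb hN) ↪g G := SimpleGraph.Embedding.comap _ _
  rcases hmem (G.comap (Fin.castLEEmb hN)) with ⟨t, ht⟩ | ⟨t, ht⟩
  · exact hs _ (SimpleGraph.IsNClique.map ht |>.mono (SimpleGraph.map_comap_le _ _))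
  · refine hk (t.map (Fin.castLEEmb hN)) ⟨?_, by simpa using ht.card_eq⟩
    rintro _ hx _ hy hxy
    simp only [coe_map, Set.mem_image, mem_coe] at hx hy
    obtain ⟨x, hx, rfl⟩ := hx
    obtain ⟨y, hy, rfl⟩ := hy
    exact ht.isIndepSet hx hy (fun h => hxy (by rw [h]))

/-! ### Counting unrelated sequences, and the union bound. -/

section Counting

/-- Sequences of pairs whose second entries lie in `S` and in which no earlier first entry is
related to a later second entry. -/
def UnrelatedSeq {A B : Type*} (R : A → B → Prop) (S : Finset B) {k : ℕ} (f : Fin k → A × B) :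
    Prop :=
  (∀ j, (f j).2 ∈ S) ∧ ∀ i j, i < j → ¬ R (f i).1 (f j).2

-- A Kleitman–Winston count. Each position is declared light or heavy (`2 ^ k`). A light pair has at
-- most `M` choices; a heavy one has up to `|A| * |B|`, but shrinks `S` by a factor `m / (m + 1)`,
-- so `T` bounds the number of heavy positions.
open Classical in
lemma card_unrelatedSeq_le {A B : Type*} [Fintype A] [Fintype B] [Nonempty A] [Nonempty B]
    (R : A → B → Prop) (m M : ℕ) (hM : 0 < M)
    (hlight : ∀ S : Finset B,
      #{a : A | (m + 1) * #{b ∈ S | R a b} < #S} * #S ≤ M) (k : ℕ) :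
    ∀ (T : ℕ) (S : Finset B), #S * m ^ T < (m + 1) ^ T →
      #{f : Fin k → A × B | UnrelatedSeq R S f} ≤
        2 ^ k * (Fintype.card A * Fintype.card B) ^ T * M ^ k := by
  have hP : 0 < Fintype.card A * Fintype.card B := Nat.mul_pos Fintype.card_pos Fintype.card_pos
  induction k with
  | zero =>
    intro T S _
    calc _ ≤ #(univ : Finset (Fin 0 → A × B)) := card_filter_le _ _
      _ = 1 := by simp
      _ ≤ _ := by simpa using Nat.one_le_pow _ _ hP
  | succ k ih =>
    intro T S hS
    set P := Fintype.card A * Fintype.card B with hPdef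
    -- Bounds the number of continuations after the first pair `p`: later second entries must avoid
    -- the relation to `p.1`.
    let c : (A × B) → ℕ := fun p =>
      if p.2 ∈ S then #{g : Fin k → A × B | UnrelatedSeq R {b ∈ S | ¬ R p.1 b} g} else 0
    have hsum : #{f : Fin (k + 1) → A × B | UnrelatedSeq R S f} ≤ ∑ p, c p := by
      rw [card_eq_sum_card_fiberwise (f := fun f => f 0) (t := univ) (by simp)]
      refine sum_le_sum fun p _ => ?_
      by_cases hp : p.2 ∈ S
      · simp only [c, hp, if_true]
        refine card_le_card_of_injOn (fun f => Fin.tail f) ?_ ?_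
        · intro f hf
          simp only [coe_filter, mem_filter, mem_univ, true_and, Set.mem_ofPred_eq] at hf ⊢
          obtain ⟨⟨h1, h2⟩, rfl⟩ := hf
          exact ⟨fun j => mem_filter.2 ⟨h1 _, h2 _ _ (Fin.succ_pos j)⟩,
            fun i j hij => h2 _ _ (Fin.succ_lt_succ_iff.2 hij)⟩
        · intro f hf g hg hfg
          simp only [coe_filter, mem_filter, mem_univ, true_and, Set.mem_ofPred_eq] at hf hg
          rw [← Fin.cons_self_tail f, ← Fin.cons_self_tail g, hf.2, hg.2, show Fin.tail f = Fin.tail g from hfg]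
      · simp only [c, hp, if_false, Nat.le_zero, card_eq_zero]
        refine filter_eq_empty_iff.2 fun f hf h => hp ?_
        rw [← h]
        exact (mem_filter.1 hf).2.1 0
    let Q : (A × B) → Prop := fun p => (m + 1) * #{b ∈ S | R p.1 b} < #S
    have hl : ∑ p with Q p, c p ≤ 2 ^ k * P ^ T * M ^ k * M := by
      have h1 : ∀ p ∈ (univ.filter Q), c p ≤ if p.2 ∈ S then 2 ^ k * P ^ T * M ^ k else 0 := by
        intro p _
        simp only [c]
        split_ifs
        · refine ih T _ (lt_of_le_of_lt ?_ hS)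
          exact Nat.mul_le_mul_right _ (card_filter_le _ _)
        · exact le_rfl
      refine (sum_le_sum h1).trans ?_
      rw [← sum_filter, sum_const, smul_eq_mul, mul_comm]
      refine Nat.mul_le_mul_left _ (le_trans ?_ (hlight S))
      rw [← card_product]
      refine card_le_card fun p hp => ?_
      simp only [mem_filter, mem_univ, true_and, mem_product, Q] at hp ⊢
      exact hp
    have hh : ∑ p with ¬ Q p, c p ≤ 2 ^ k * P ^ T * M ^ k := by
      -- With no heavy step left, the hypothesis on `S` forces it to be empty.
      rcases T with _ | T
      · have : S = ∅ := by simpa using hS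
        subst this
        simp [c]
      · have h1 : ∀ p ∈ (univ.filter fun p => ¬ Q p), c p ≤ 2 ^ k * P ^ T * M ^ k := by
          intro p hp
          have hp' : #S ≤ (m + 1) * #{b ∈ S | R p.1 b} := by
            simpa [Q] using hp
          simp only [c]
          split_ifs
          · refine ih T _ ?_
            have hadd := card_filter_add_card_filter_not (s := S) (fun b => R p.1 b)
            have h2 : #{b ∈ S | ¬ R p.1 b} * (m + 1) ≤ #S * m := by nlinarith
            refine lt_of_mul_lt_mul_right ?_ (Nat.zero_le (m + 1))
            calc #{b ∈ S | ¬ R p.1 b} * m ^ T * (m + 1)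
                = #{b ∈ S | ¬ R p.1 b} * (m + 1) * m ^ T := by ring
              _ ≤ #S * m * m ^ T := Nat.mul_le_mul_right _ h2
              _ = #S * m ^ (T + 1) := by ring
              _ < (m + 1) ^ (T + 1) := hS
              _ = _ := by ring
          · exact Nat.zero_le _
        refine (sum_le_card_nsmul _ _ _ h1).trans ?_
        rw [smul_eq_mul]
        calc _ ≤ P * (2 ^ k * P ^ T * M ^ k) := by
              refine Nat.mul_le_mul_right _ ((card_filter_le _ _).trans ?_)
              simp [P]
          _ = _ := by ring
    calc _ ≤ ∑ p, c p := hsum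
      _ = ∑ p with Q p, c p + ∑ p with ¬ Q p, c p := (sum_filter_add_sum_filter_not _ _ _).symm
      _ ≤ 2 ^ k * P ^ T * M ^ k * M + 2 ^ k * P ^ T * M ^ k * M :=
          add_le_add hl (hh.trans (Nat.le_mul_of_pos_right _ hM))
      _ = _ := by ring

/-- The union bound for random maps `Fin N → X`. -/
lemma exists_forall_comp_notMem {X : Type*} [Fintype X] [Nonempty X] {k : ℕ}
    (B : Finset (Fin k → X)) (N : ℕ) (h : N ^ k * #B < Fintype.card X ^ k) :
    ∃ f : Fin N → X, ∀ e : Fin k ↪ Fin N, f ∘ e ∉ B := by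
  classical
  rcases lt_or_ge N k with hNk | hkN
  · refine ⟨fun _ => Classical.arbitrary X, fun e => ?_⟩
    have := Fintype.card_le_of_embedding e
    simp at this
    omega
  by_contra! hcon
  have hsub : (univ : Finset (Fin N → X)) ⊆
      univ.biUnion fun e : Fin k ↪ Fin N => {f | f ∘ e ∈ B} := by
    intro f _
    obtain ⟨e, he⟩ := hcon f
    simp only [mem_biUnion, mem_univ, true_and, mem_filter]
    exact ⟨e, he⟩
  have hone : ∀ e : Fin k ↪ Fin N,
      #{f : Fin N → X | f ∘ e ∈ B} ≤ #B * Fintype.card X ^ (N - k) := by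
    intro e
    have hc : Fintype.card {i // i ∉ Set.range e} = N - k := by
      have := Fintype.card_subtype_compl (fun i => i ∈ Set.range e)
      rw [this, Fintype.card_fin]
      rw [← Nat.card_eq_fintype_card]
      exact congrArg (N - ·) ((Nat.card_range_of_injective e.injective).trans (by simp))
    have : #B * Fintype.card X ^ (N - k) =
        #(B ×ˢ (univ : Finset ({i // i ∉ Set.range e} → X))) := by
      rw [card_product, card_univ, Fintype.card_fun, hc]
    rw [this]
    refine card_le_card_of_injOn (fun f => (f ∘ e, fun i => f i)) ?_ ?_
    · intro f hf
      simpa using hf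
    · intro f _ g _ hfg
      simp only [Prod.mk.injEq] at hfg
      funext i
      by_cases hi : i ∈ Set.range e
      · obtain ⟨j, rfl⟩ := hi
        exact congrFun hfg.1 j
      · exact congrFun hfg.2 ⟨i, hi⟩
  have hcard := (card_le_card hsub).trans (card_biUnion_le.trans (sum_le_card_nsmul _ _ _
    fun e _ => hone e))
  have hemb : #(univ : Finset (Fin k ↪ Fin N)) ≤ N ^ k := by
    rw [card_univ]
    calc _ ≤ Fintype.card (Fin k → Fin N) :=
          Fintype.card_le_of_injective _ DFunLike.coe_injective
      _ = _ := by simp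
  rw [card_univ, Fintype.card_fun, Fintype.card_fin, smul_eq_mul] at hcard
  have : Fintype.card X ^ N = Fintype.card X ^ k * Fintype.card X ^ (N - k) := by
    rw [← pow_add]; congr 1; omega
  rw [this, ← mul_assoc] at hcard
  have h3 := Nat.le_of_mul_le_mul_right hcard (pow_pos Fintype.card_pos _)
  exact absurd (h3.trans (Nat.mul_le_mul_right _ hemb)) (not_le.2 h)

end Counting

/-! ### Orthogonality over a finite field, and the random graph. -/

section Orthogonality

variable {F : Type*} [Field F] {d : ℕ}

/-- Vectors that pair to a triangular matrix with nonzero diagonal are at most `d` in number. -/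
lemma card_le_of_triangular {ι : Type*} [LinearOrder ι] (t : Finset ι) (u v : ι → Fin d → F)
    (hdiag : ∀ i ∈ t, u i ⬝ᵥ v i ≠ 0) (htri : ∀ i ∈ t, ∀ j ∈ t, i < j → u i ⬝ᵥ v j = 0) :
    #t ≤ d := by
  have hli : LinearIndependent F fun i : t => u i := by
    rw [Fintype.linearIndependent_iff]
    intro c hc
    by_contra! hne
    obtain ⟨i₀, hi₀⟩ := hne
    classical
    -- Pairing a dependency with `v j`, for `j` the last index of its support, leaves only the
    -- diagonal term.
    obtain ⟨j, hj, hmax⟩ := exists_max_image ({i | c i ≠ 0} : Finset t) id ⟨i₀, by simpa using hi₀⟩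
    have hj' : c j ≠ 0 := by simpa using hj
    have h := congrArg (· ⬝ᵥ v j) hc
    simp only [sum_dotProduct, smul_dotProduct, zero_dotProduct, smul_eq_mul] at h
    rw [sum_eq_single j] at h
    · exact (mul_ne_zero hj' (hdiag j j.2)) h
    · intro i _ hij
      by_cases hci : c i = 0
      · simp [hci]
      · have : i ≤ j := hmax i (by simpa using hci)
        rw [htri i i.2 j j.2 (lt_of_le_of_ne this (Subtype.coe_ne_coe.2 hij)), mul_zero]
    · simp
  simpa using hli.fintype_card_le_finrank

variable [Fintype F]

open Classical in
lemma card_orthogonal_mul_card_le {x : Fin d → F} (hx : x ≠ 0) :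
    #{a : Fin d → F | a ⬝ᵥ x = 0} * Fintype.card F ≤ Fintype.card F ^ d := by
  obtain ⟨i, hi⟩ : ∃ i, x i ≠ 0 := by
    by_contra! h
    exact hx (funext h)
  let e : Fin d → F := Pi.single i (x i)⁻¹
  have he : e ⬝ᵥ x = 1 := by simp [e, hi]
  calc _ = #(({a : Fin d → F | a ⬝ᵥ x = 0} : Finset _) ×ˢ (univ : Finset F)) := by
        rw [card_product, card_univ]
    _ ≤ #(univ : Finset (Fin d → F)) := by
        refine card_le_card_of_injOn (fun p => p.1 + p.2 • e) (by simp) ?_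
        rintro ⟨a, t⟩ ha ⟨b, r⟩ hb hab
        simp only [coe_product, coe_filter, mem_univ, true_and, coe_univ, Set.mem_prod,
          Set.mem_ofPred_eq, Set.mem_univ, and_true] at ha hb hab
        have h1 := congrArg (· ⬝ᵥ x) hab
        simp only [add_dotProduct, smul_dotProduct, he, ha, hb, smul_eq_mul, mul_one,
          zero_add] at h1
        subst h1
        simpa using hab
    _ = _ := by simp

open Classical in
/-- The fibres of `b ↦ a ⬝ᵥ b` on a set `S` are close to uniform for most `a`. -/
lemma sum_sq_card_fiber_sub_le (S : Finset (Fin d → F)) :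
    ∑ a : Fin d → F, ∑ t : F,
      ((#{b ∈ S | a ⬝ᵥ b = t} : ℝ) - #S / Fintype.card F) ^ 2 ≤ #S * Fintype.card F ^ d := by
  set q : ℝ := (Fintype.card F : ℝ) with hq
  have hq0 : 0 < q := by simp [hq, Fintype.card_pos]
  have hfib : ∀ a : Fin d → F, ∑ t : F, (#{b ∈ S | a ⬝ᵥ b = t} : ℝ) = #S := by
    intro a
    rw [card_eq_sum_card_fiberwise (f := fun b => a ⬝ᵥ b) (s := S) (t := univ) (by simp)]
    simp
  have hsq : ∀ a : Fin d → F, ∑ t : F, (#{b ∈ S | a ⬝ᵥ b = t} : ℝ) ^ 2 =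
      ∑ b ∈ S, ∑ b' ∈ S, if a ⬝ᵥ (b - b') = 0 then (1 : ℝ) else 0 := by
    intro a
    have h1 : ∀ t : F, (#{b ∈ S | a ⬝ᵥ b = t} : ℝ) ^ 2 =
        ∑ b ∈ S, ∑ b' ∈ S, if a ⬝ᵥ b = t then (if a ⬝ᵥ b' = t then (1 : ℝ) else 0) else 0 := by
      intro t
      rw [sq, card_filter]
      push_cast
      rw [sum_mul_sum]
      simp only [ite_mul, one_mul, zero_mul]
    simp_rw [h1]
    rw [sum_comm]
    refine sum_congr rfl fun b _ => ?_
    rw [sum_comm]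
    refine sum_congr rfl fun b' _ => ?_
    rw [sum_ite_eq]
    simp [dotProduct_sub, sub_eq_zero, eq_comm]
  have hexp : ∀ a : Fin d → F, ∑ t : F, ((#{b ∈ S | a ⬝ᵥ b = t} : ℝ) - #S / q) ^ 2 =
      (∑ b ∈ S, ∑ b' ∈ S, if a ⬝ᵥ (b - b') = 0 then (1 : ℝ) else 0) - (#S : ℝ) ^ 2 / q := by
    intro a
    simp_rw [sub_sq]
    rw [sum_add_distrib, sum_sub_distrib, hsq, ← sum_mul, ← mul_sum, hfib, sum_const, card_univ,
      nsmul_eq_mul, ← hq]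
    field_simp
    ring
  simp_rw [hexp]
  rw [sum_sub_distrib, sum_comm]
  have hpair : ∀ b b' : Fin d → F,
      (∑ a : Fin d → F, if a ⬝ᵥ (b - b') = 0 then (1 : ℝ) else 0) ≤
        (if b = b' then q ^ d else 0) + q ^ d / q := by
    intro b b'
    rw [sum_boole]
    split_ifs with h
    · subst h
      have : 0 ≤ q ^ d / q := by positivity
      simpa [hq] using this
    · rw [zero_add, le_div_iff₀ hq0]
      rw [hq]
      exact_mod_cast card_orthogonal_mul_card_le (sub_ne_zero.2 h)
  have htot : ∑ b ∈ S, ∑ a : Fin d → F, ∑ b' ∈ S,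
      (if a ⬝ᵥ (b - b') = 0 then (1 : ℝ) else 0) ≤ #S * q ^ d + (#S : ℝ) ^ 2 * (q ^ d / q) := by
    calc _ ≤ ∑ b ∈ S, ∑ b' ∈ S, ((if b = b' then q ^ d else 0) + q ^ d / q) := by
          refine sum_le_sum fun b _ => ?_
          rw [sum_comm]
          exact sum_le_sum fun b' _ => hpair b b'
      _ = ∑ b ∈ S, (q ^ d + #S * (q ^ d / q)) := by
          refine sum_congr rfl fun b hb => ?_
          rw [sum_add_distrib, sum_ite_eq, if_pos hb, sum_const, nsmul_eq_mul]
      _ = _ := by rw [sum_const, nsmul_eq_mul]; ring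
  have hconst : ∑ _a : Fin d → F, (#S : ℝ) ^ 2 / q = (#S : ℝ) ^ 2 * (q ^ d / q) := by
    rw [sum_const, card_univ, Fintype.card_fun, Fintype.card_fin, nsmul_eq_mul]
    push_cast
    rw [← hq]
    ring
  linarith

-- Chebyshev: for such an `a`, the fibre over `0` alone contributes at least `(#S / (2q)) ^ 2` to
-- the preceding variance sum.
open Classical in
lemma card_light_mul_card_le (S : Finset (Fin d → F)) :
    #{a : Fin d → F | 2 * Fintype.card F * #{b ∈ S | a ⬝ᵥ b = 0} < #S} * #S ≤
      4 * Fintype.card F ^ (d + 2) := by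
  rcases S.eq_empty_or_nonempty with rfl | hS
  · simp
  set q : ℝ := (Fintype.card F : ℝ) with hq
  have hq0 : 0 < q := by simp [hq, Fintype.card_pos]
  have hS0 : (0 : ℝ) < #S := by exact_mod_cast card_pos.2 hS
  set L : Finset (Fin d → F) := {a | 2 * Fintype.card F * #{b ∈ S | a ⬝ᵥ b = 0} < #S} with hL
  have h1 : (#L : ℝ) * (#S / (2 * q)) ^ 2 ≤ #S * q ^ d := by
    calc (#L : ℝ) * (#S / (2 * q)) ^ 2 = ∑ a ∈ L, ((#S : ℝ) / (2 * q)) ^ 2 := by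
          rw [sum_const, nsmul_eq_mul]
      _ ≤ ∑ a ∈ L, ∑ t : F, ((#{b ∈ S | a ⬝ᵥ b = t} : ℝ) - #S / q) ^ 2 := by
          refine sum_le_sum fun a ha => ?_
          refine le_trans ?_ (single_le_sum (f := fun t : F =>
            ((#{b ∈ S | a ⬝ᵥ b = t} : ℝ) - #S / q) ^ 2) (fun t _ => sq_nonneg _) (mem_univ 0))
          have h2 : 2 * q * (#{b ∈ S | a ⬝ᵥ b = 0} : ℝ) < #S := by
            rw [hq]; exact_mod_cast (mem_filter.1 ha).2
          have h3 : (#{b ∈ S | a ⬝ᵥ b = 0} : ℝ) ≤ #S / (2 * q) := by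
            rw [le_div_iff₀ (by positivity)]; linarith
          have h4 : (#S : ℝ) / q = #S / (2 * q) + #S / (2 * q) := by field_simp; ring
          have h5 : 0 ≤ (#S : ℝ) / (2 * q) := by positivity
          rw [h4]
          nlinarith
      _ ≤ ∑ a, ∑ t : F, ((#{b ∈ S | a ⬝ᵥ b = t} : ℝ) - #S / q) ^ 2 :=
          sum_le_sum_of_subset_of_nonneg (subset_univ _)
            fun a _ _ => sum_nonneg fun t _ => sq_nonneg _
      _ ≤ _ := sum_sq_card_fiber_sub_le S
  have h2 : (#L : ℝ) * #S ≤ 4 * q ^ (d + 2) := by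
    rw [div_pow, mul_div_assoc', div_le_iff₀ (by positivity)] at h1
    refine le_of_mul_le_mul_right ?_ hS0
    calc (#L : ℝ) * #S * #S = #L * #S ^ 2 := by ring
      _ ≤ _ := h1
      _ = _ := by ring
  rw [hq] at h2
  exact_mod_cast h2

open Classical in
lemma card_pow_le_card_nonorthogonal (m : ℕ) :
    Fintype.card F ^ (2 * m) ≤
      Fintype.card {p : (Fin (m + 1) → F) × (Fin (m + 1) → F) // p.1 ⬝ᵥ p.2 ≠ 0} := by
  have h : Fintype.card ((Fin m → F) × (Fin m → F)) = Fintype.card F ^ (2 * m) := by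
    simp [two_mul, pow_add]
  rw [← h]
  -- The two first coordinates are chosen to make the product equal to `1`.
  refine Fintype.card_le_of_injective (fun p =>
    ⟨(Matrix.vecCons 1 p.1, Matrix.vecCons (1 - p.1 ⬝ᵥ p.2) p.2), by simp⟩) ?_
  rintro ⟨a, b⟩ ⟨a', b'⟩ h
  simp only [Subtype.mk.injEq, Prod.mk.injEq, Matrix.vecCons_inj, true_and] at h
  simp [h.1, h.2.2]

lemma exists_graph_of_field (m k T N : ℕ)
    (hT : Fintype.card F ^ (m + 1) * (2 * Fintype.card F - 1) ^ T < (2 * Fintype.card F) ^ T)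
    (hN : N ^ k * (2 ^ k * (Fintype.card F ^ (2 * (m + 1))) ^ T *
      (4 * Fintype.card F ^ (m + 3)) ^ k) < (Fintype.card F ^ (2 * m)) ^ k) :
    ∃ G : SimpleGraph (Fin N), (∀ t, ¬ G.IsNClique (m + 2) t) ∧ ∀ t, ¬ G.IsNIndepSet k t := by
  classical
  set q := Fintype.card F with hq
  have hq0 : 0 < q := Fintype.card_pos
  let V := Fin (m + 1) → F
  let X := {p : V × V // p.1 ⬝ᵥ p.2 ≠ 0}
  have hXcard : q ^ (2 * m) ≤ Fintype.card X := card_pow_le_card_nonorthogonal m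
  have : Nonempty X := Fintype.card_pos_iff.1 (lt_of_lt_of_le (pow_pos hq0 _) hXcard)
  let R : V → V → Prop := fun a b => a ⬝ᵥ b = 0
  have hcount : #{f : Fin k → V × V | UnrelatedSeq R univ f} ≤
      2 ^ k * (q ^ (2 * (m + 1))) ^ T * (4 * q ^ (m + 3)) ^ k := by
    have h2q : 2 * q - 1 + 1 = 2 * q := by omega
    have hP : Fintype.card V * Fintype.card V = q ^ (2 * (m + 1)) := by
      simp [V, hq, two_mul, pow_add]
    rw [← hP]
    refine card_unrelatedSeq_le R (2 * q - 1) (4 * q ^ (m + 3)) (by positivity) ?_ k T univ ?_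
    · intro S
      rw [h2q]
      exact card_light_mul_card_le S
    · rw [h2q]
      simpa [V] using hT
  let B : Finset (Fin k → X) := {f | UnrelatedSeq R univ fun i => (f i).1}
  have hB : #B ≤ 2 ^ k * (q ^ (2 * (m + 1))) ^ T * (4 * q ^ (m + 3)) ^ k := by
    refine le_trans (card_le_card_of_injOn (fun f i => (f i).1) ?_ ?_) hcount
    · intro f hf
      simpa [B] using hf
    · intro f _ g _ hfg
      funext i
      exact Subtype.ext (congrFun hfg i)
  obtain ⟨f, hf⟩ := exists_forall_comp_notMem B N <|
    (Nat.mul_le_mul_left _ hB).trans_lt (hN.trans_le (Nat.pow_le_pow_left hXcard k))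
  refine ⟨SimpleGraph.fromRel fun i j => i < j ∧ (f i).1.1 ⬝ᵥ (f j).1.2 = 0, ?_, ?_⟩
  · intro t ht
    have := card_le_of_triangular t (fun i => (f i).1.1) (fun i => (f i).1.2)
      (fun i _ => (f i).2) (fun i hi j hj hij => ?_)
    · rw [ht.card_eq] at this
      omega
    · have h := ht.isClique hi hj hij.ne
      rw [SimpleGraph.fromRel_adj] at h
      rcases h.2 with h | h
      · exact h.2
      · exact absurd h.1 hij.asymm
  · intro t ht
    have hcard := ht.card_eq
    -- Listed in increasing order, an independent set becomes an unrelated sequence.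
    refine hf (t.orderEmbOfFin hcard).toEmbedding (mem_filter.2 ⟨mem_univ _, by simp, ?_⟩)
    intro i j hij hR
    have hlt : t.orderEmbOfFin hcard i < t.orderEmbOfFin hcard j := by simpa using hij
    refine ht.isIndepSet (orderEmbOfFin_mem t hcard i) (orderEmbOfFin_mem t hcard j) hlt.ne ?_
    rw [SimpleGraph.fromRel_adj]
    exact ⟨hlt.ne, .inl ⟨hlt, hR⟩⟩

end Orthogonality
-- Choice of parameters for the lower bound.
lemma exists_graph_of_prime {q s k T N : ℕ} (hq : q.Prime) (hs : 2 ≤ s) (hN0 : 0 < N)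
    (hT : 2 * (q : ℝ) * s * Real.log q < T)
    (hN : k * Real.log N + 3 * k * Real.log 2 + 2 * s * T * Real.log q + (s + 1) * k * Real.log q <
      (2 * s - 4) * k * Real.log q) :
    ∃ G : SimpleGraph (Fin N), (∀ t, ¬ G.IsNClique s t) ∧ ∀ t, ¬ G.IsNIndepSet k t := by
  obtain ⟨m, rfl⟩ := Nat.exists_eq_add_of_le' hs
  have : Fact q.Prime := ⟨hq⟩
  have hq2 : (2 : ℝ) ≤ q := by exact_mod_cast hq.two_le
  have hq0 : (0 : ℝ) < q := by linarith
  have hlog : 0 < Real.log q := Real.log_pos (by linarith)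
  have hNr : (0 : ℝ) < N := by exact_mod_cast hN0
  push_cast at hT hN
  refine exists_graph_of_field (F := ZMod q) m k T N ?_ ?_
  · rw [ZMod.card]
    have h1 : (1 : ℝ) - 1 / (2 * q) ≤ Real.exp (-(1 / (2 * q))) := by
      linarith [Real.add_one_le_exp (-(1 / (2 * (q : ℝ))))]
    have h0 : (0 : ℝ) ≤ 1 - 1 / (2 * q) := by
      rw [sub_nonneg, div_le_one (by positivity)]; linarith
    have h2 : (q : ℝ) ^ (m + 1) * (1 - 1 / (2 * q)) ^ T < 1 := by
      calc (q : ℝ) ^ (m + 1) * (1 - 1 / (2 * q)) ^ T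
          ≤ Real.exp (Real.log q) ^ (m + 1) * Real.exp (-(1 / (2 * q))) ^ T := by
            rw [Real.exp_log hq0]; gcongr
        _ = Real.exp ((m + 1) * Real.log q - T / (2 * q)) := by
            rw [← Real.exp_nat_mul, ← Real.exp_nat_mul, ← Real.exp_add]
            congr 1; push_cast; ring
        _ < 1 := by
            rw [Real.exp_lt_one_iff, sub_neg, lt_div_iff₀ (by positivity)]
            nlinarith [mul_pos hq0 hlog]
    have h3 : (q : ℝ) ^ (m + 1) * (2 * q - 1) ^ T < (2 * q) ^ T := by
      have h4 : (2 * (q : ℝ) - 1) = (1 - 1 / (2 * q)) * (2 * q) := by field_simp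
      rw [h4, mul_pow, ← mul_assoc]
      exact mul_lt_of_lt_one_left (by positivity) h2
    have h5 : ((2 * q - 1 : ℕ) : ℝ) = 2 * q - 1 := by
      rw [Nat.cast_sub (by have := hq.two_le; omega)]; push_cast; ring
    rw [← h5] at h3
    exact_mod_cast h3
  · rw [ZMod.card]
    have key : (N : ℝ) ^ k * (2 ^ k * ((q : ℝ) ^ (2 * (m + 1))) ^ T * (4 * (q : ℝ) ^ (m + 3)) ^ k) <
        ((q : ℝ) ^ (2 * m)) ^ k := by
      rw [← Real.log_lt_log_iff (by positivity) (by positivity),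
        Real.log_mul (by positivity) (by positivity), Real.log_mul (by positivity) (by positivity),
        Real.log_mul (by positivity) (by positivity)]
      simp only [Real.log_pow]
      rw [Real.log_mul (by positivity) (by positivity), show (4 : ℝ) = 2 ^ 2 by norm_num]
      simp only [Real.log_pow]
      push_cast
      nlinarith [mul_nonneg (Nat.cast_nonneg (α := ℝ) T) hlog.le]
    exact_mod_cast key

lemma exists_rpow_large {δ η : ℝ} (hδ : 0 < δ) (hη : 0 < η) :
    ∃ X : ℝ, 1 < X ∧ ∀ x, X ≤ x → 2 ≤ x ^ η ∧ 48 * Real.log x ≤ δ * x ^ η := by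
  have h1 := (tendsto_rpow_atTop hη).eventually_ge_atTop 2
  have h2 := (isLittleO_log_rpow_atTop hη).bound (show 0 < δ / 48 by positivity)
  obtain ⟨X, hX⟩ := Filter.eventually_atTop.1 (h1.and h2)
  refine ⟨max X 2, by simp, fun x hx => ?_⟩
  obtain ⟨h3, h4⟩ := hX x ((le_max_left _ _).trans hx)
  refine ⟨h3, ?_⟩
  rw [Real.norm_of_nonneg (by positivity : 0 ≤ x ^ η)] at h4
  linarith [(Real.le_norm_self (Real.log x)).trans h4]

lemma exists_rpow_le_ramseyNumber_of_lt_one {δ : ℝ} (hδ : 0 < δ) (hδ1 : δ < 1) :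
    ∃ L : ℝ, 1 ≤ L ∧ ∀ s k : ℕ, 0 < s → L ≤ (s : ℝ) → L * (s : ℝ) ≤ (k : ℝ) →
      ((k : ℝ) / (s : ℝ)) ^ ((1 - δ) * (s : ℝ)) ≤ (ramseyNumber s k : ℝ) := by
  obtain ⟨X, hX1, hX⟩ := exists_rpow_large hδ (show 0 < δ / 8 by positivity)
  refine ⟨max X (16 / δ), hX1.le.trans (le_max_left _ _), fun s k hs hLs hk => ?_⟩
  have hs0 : (0 : ℝ) < s := by exact_mod_cast hs
  have hsδ : 16 ≤ δ * s := by
    have := (le_max_right X (16 / δ)).trans hLs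
    rw [div_le_iff₀ hδ] at this
    linarith
  have hs2 : 2 ≤ s := by
    have : (2 : ℝ) ≤ s := by nlinarith
    exact_mod_cast this
  set x : ℝ := (k : ℝ) / s with hx
  have hkx : (k : ℝ) = x * s := by rw [hx]; field_simp
  have hXx : X ≤ x := by
    rw [hx, le_div_iff₀ hs0]
    exact (mul_le_mul_of_nonneg_right (le_max_left _ _) hs0.le).trans hk
  have hx1 : 1 < x := hX1.trans_le hXx
  have hx0 : 0 < x := by linarith
  obtain ⟨hx2, hx48⟩ := hX x hXx
  have hk0 : (0 : ℝ) < k := by rw [hkx]; positivity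
  have hlx : 0 < Real.log x := Real.log_pos hx1
  -- The spare factor `x ^ (δ / 8)` absorbs the logarithm in `T`; Bertrand's postulate then gives a
  -- prime `q` in `[y / 2, y]`.
  set y : ℝ := x ^ (1 - δ / 8) with hy
  have hxy : y * x ^ (δ / 8) = x := by
    rw [hy, ← Real.rpow_add hx0]; simp
  have hy2 : 2 ≤ y := hx2.trans (Real.rpow_le_rpow_of_exponent_le hx1.le (by linarith))
  have hyx : y ≤ x := by
    nlinarith
  obtain ⟨q, hq, hql, hqu⟩ := Nat.exists_prime_lt_and_le_two_mul ⌊y / 2⌋₊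
    (Nat.floor_pos.2 (by linarith)).ne'
  have hqy : (q : ℝ) ≤ y := by
    have h1 : (q : ℝ) ≤ 2 * (⌊y / 2⌋₊ : ℝ) := by exact_mod_cast hqu
    have h2 := Nat.floor_le (show 0 ≤ y / 2 by linarith)
    linarith
  have hyq : y / 2 ≤ q := by
    have h1 : ((⌊y / 2⌋₊ : ℝ) + 1) ≤ q := by exact_mod_cast hql
    linarith [Nat.lt_floor_add_one (y / 2)]
  have hq2 : (2 : ℝ) ≤ q := by exact_mod_cast hq.two_le
  have hl2 : Real.log 2 ≤ Real.log q := Real.log_le_log (by norm_num) hq2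
  have hlog2 : 1 / 2 < Real.log 2 := by linarith [Real.log_two_gt_d9]
  have hlqx : Real.log q ≤ Real.log x := Real.log_le_log (by linarith) (hqy.trans hyx)
  have hlxq : (1 - δ / 4) * Real.log x ≤ Real.log q := by
    have h1 := Real.log_le_log (by linarith) hyq
    rw [Real.log_div (by linarith) (by norm_num), hy, Real.log_rpow hx0] at h1
    have h2 := Real.log_le_log (by norm_num) hx2
    rw [Real.log_rpow hx0] at h2
    linarith
  set N : ℕ := ⌊x ^ ((1 - δ) * (s : ℝ))⌋₊ with hN
  have hpow1 : 1 ≤ x ^ ((1 - δ) * (s : ℝ)) :=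
    Real.one_le_rpow hx1.le (mul_nonneg (by linarith) hs0.le)
  have hN0 : 0 < N := Nat.floor_pos.2 hpow1
  have hlN : Real.log N ≤ (1 - δ) * s * Real.log x := by
    rw [← Real.log_rpow hx0]
    exact Real.log_le_log (by exact_mod_cast hN0) (Nat.floor_le (by linarith))
  set T : ℕ := ⌊2 * (q : ℝ) * s * Real.log q⌋₊ + 1 with hT
  have hT1 : 2 * (q : ℝ) * s * Real.log q < T := by
    rw [hT]; exact_mod_cast Nat.lt_floor_add_one _
  have hTk : 16 * (T : ℝ) ≤ δ * k := by
    have h1 : (T : ℝ) ≤ 2 * (q : ℝ) * s * Real.log q + 1 := by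
      rw [hT]; push_cast
      gcongr
      exact Nat.floor_le (by positivity)
    have h2 : 1 ≤ (q : ℝ) * s * Real.log q := by
      have hs2' : (2 : ℝ) ≤ s := by exact_mod_cast hs2
      calc (1 : ℝ) ≤ 2 * 2 * (1 / 2) := by norm_num
        _ ≤ _ := by gcongr; linarith
    have h3 : (q : ℝ) * s * Real.log q ≤ y * s * Real.log x := by gcongr
    calc 16 * (T : ℝ) ≤ y * s * (48 * Real.log x) := by linarith
      _ ≤ y * s * (δ * x ^ (δ / 8)) := by gcongr
      _ = δ * (y * x ^ (δ / 8) * s) := by ring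
      _ = δ * k := by rw [hxy, hkx]
  obtain ⟨G, hG1, hG2⟩ := exists_graph_of_prime (k := k) hq hs2 hN0 hT1 (by
    have hT' : 2 * s * T * Real.log q ≤ k * (δ / 8 * s * Real.log q) := by
      have : 0 ≤ (s : ℝ) * Real.log q := by positivity
      nlinarith
    -- The `8` collects `5` from `(2s - 4) - (s + 1)` and `3` from `3 log 2 ≤ 3 log q`. As `8 ≤
    -- δs/2`, it suffices that `(1 - 5δ/8)(1 - δ/4) > 1 - δ`.
    have hmain : (1 - δ) * s * Real.log x < (s * (1 - δ / 8) - 8) * Real.log q := by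
      have h8 : 0 ≤ s * (1 - δ / 8) - 8 := by nlinarith
      calc (1 - δ) * s * Real.log x < ((s * (1 - δ / 8) - 8) * (1 - δ / 4)) * Real.log x := by
            refine mul_lt_mul_of_pos_right ?_ hlx
            nlinarith [mul_pos (mul_pos hδ hδ) hs0]
        _ = (s * (1 - δ / 8) - 8) * ((1 - δ / 4) * Real.log x) := by ring
        _ ≤ _ := by gcongr
    have hin : Real.log N + 3 * Real.log 2 + δ / 8 * s * Real.log q + (s + 1) * Real.log q <
        (2 * s - 4) * Real.log q := by linarith
    have := mul_lt_mul_of_pos_left hin hk0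
    linarith)
  have hlt := lt_ramseyNumber G hG1 hG2
  have h1 : ((N : ℝ) + 1) ≤ ramseyNumber s k := by exact_mod_cast hlt
  linarith [Nat.lt_floor_add_one (x ^ ((1 - δ) * (s : ℝ)))]

/-- The lower bound on Ramsey numbers. -/
lemma exists_rpow_le_ramseyNumber {δ : ℝ} (hδ : 0 < δ) :
    ∃ L : ℝ, ∀ s k : ℕ, 0 < s → L ≤ (s : ℝ) → L * (s : ℝ) ≤ (k : ℝ) →
      ((k : ℝ) / (s : ℝ)) ^ ((1 - δ) * (s : ℝ)) ≤ (ramseyNumber s k : ℝ) := by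
  obtain ⟨L, hL1, hL⟩ := exists_rpow_le_ramseyNumber_of_lt_one (δ := min δ (1 / 2))
    (by positivity) (by simp; norm_num)
  refine ⟨L, fun s k hs hLs hk => le_trans ?_ (hL s k hs hLs hk)⟩
  have hs0 : (0 : ℝ) < s := by exact_mod_cast hs
  refine Real.rpow_le_rpow_of_exponent_le ?_ ?_
  · rw [le_div_iff₀ hs0]
    nlinarith
  · gcongr
    exact min_le_left _ _

/-! ### Upper bound and asymptotics. -/

/-- The upper bound on Ramsey numbers. -/
lemma ramseyNumber_le_pow {s k : ℕ} (hs : 0 < s) (hsk : s ≤ k) :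
    (ramseyNumber s k : ℝ) ≤ (2 * Real.exp 1 * (k / s)) ^ s := by
  have hs0 : (0 : ℝ) < s := by exact_mod_cast hs
  have hsk' : (s : ℝ) ≤ k := by exact_mod_cast hsk
  calc (ramseyNumber s k : ℝ) ≤ ((s + k).choose s : ℕ) := by
        exact_mod_cast ramseyNumber_le_choose s k
    _ ≤ ((s + k : ℕ) : ℝ) ^ s / s.factorial := Nat.choose_le_pow_div s (s + k)
    _ ≤ (2 * k) ^ s / s.factorial := by
        gcongr
        push_cast
        linarith
    _ = (2 * (k / s)) ^ s * ((s : ℝ) ^ s / s.factorial) := by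
        rw [mul_div_assoc', ← mul_pow]
        congr 2
        field_simp
    _ ≤ (2 * (k / s)) ^ s * Real.exp s := by
        gcongr
        exact Real.pow_div_factorial_le_exp _ hs0.le s
    _ = _ := by
        rw [← Real.exp_one_pow, ← mul_pow]
        ring

lemma exists_ramseyNumber_eq_rpow (s k : ℕ → ℕ) (hs : Filter.Tendsto s Filter.atTop Filter.atTop)
    (hk : Filter.Tendsto (fun n => (k n : ℝ) / (s n : ℝ)) Filter.atTop Filter.atTop) :
    ∃ ε : ℕ → ℝ, Filter.Tendsto ε Filter.atTop (nhds 0) ∧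
      ∀ᶠ n in Filter.atTop, (ramseyNumber (s n) (k n) : ℝ) =
        ((k n : ℝ) / (s n : ℝ)) ^ ((1 + ε n) * (s n : ℝ)) := by
  have hpos : ∀ δ : ℝ, 0 < δ → ∀ᶠ n in Filter.atTop, (0 : ℝ) < s n ∧ 1 < (k n : ℝ) / s n ∧
      ((k n : ℝ) / s n) ^ ((1 - δ) * (s n : ℝ)) ≤ ramseyNumber (s n) (k n) := by
    intro δ hδ
    obtain ⟨L, hL⟩ := exists_rpow_le_ramseyNumber hδ
    filter_upwards [hs.eventually_gt_atTop 0, hk.eventually_gt_atTop 1, hk.eventually_ge_atTop L,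
      (tendsto_natCast_atTop_atTop.comp hs).eventually_ge_atTop L] with n h1 h2 h3 h4
    have h1' : (0 : ℝ) < s n := by exact_mod_cast h1
    exact ⟨h1', h2, hL _ _ h1 h4 ((le_div_iff₀ h1').1 h3)⟩
  -- This `ε` solves the required equation exactly; the two bounds show that it tends to `0`.
  refine ⟨fun n => Real.log (ramseyNumber (s n) (k n)) / (s n * Real.log ((k n : ℝ) / s n)) - 1,
    ?_, ?_⟩
  · rw [Metric.tendsto_nhds]
    intro δ hδ
    filter_upwards [hpos (δ / 2) (by positivity), (Real.tendsto_log_atTop.comp hk).eventually_ge_atTop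
      (2 * Real.log (2 * Real.exp 1) / δ)] with n ⟨hs0, hx1, hlow⟩ hlarge
    set x : ℝ := (k n : ℝ) / s n with hx
    have hx0 : 0 < x := by linarith
    have hlx : 0 < Real.log x := Real.log_pos hx1
    have hden : 0 < s n * Real.log x := mul_pos hs0 hlx
    have hr0 : (0 : ℝ) < ramseyNumber (s n) (k n) := lt_of_lt_of_le (by positivity) hlow
    have hlow' := Real.log_le_log (by positivity) hlow
    rw [Real.log_rpow hx0] at hlow'
    have hsk : s n ≤ k n := by
      have := (lt_div_iff₀ hs0).1 hx1
      rw [one_mul] at this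
      exact_mod_cast this.le
    have hup := Real.log_le_log hr0 (ramseyNumber_le_pow (by exact_mod_cast hs0) hsk)
    rw [Real.log_pow, Real.log_mul (by positivity) hx0.ne'] at hup
    simp only [Function.comp_apply] at hlarge
    rw [div_le_iff₀ hδ] at hlarge
    rw [Real.dist_eq, sub_zero, abs_lt, lt_sub_iff_add_lt, sub_lt_iff_lt_add, lt_div_iff₀ hden,
      div_lt_iff₀ hden]
    constructor <;> nlinarith
  -- At `δ = 1` the lower bound has exponent `0` and gives positivity of the Ramsey number.
  · filter_upwards [hpos 1 one_pos] with n ⟨hs0, hx1, hlow⟩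
    have hx0 : 0 < (k n : ℝ) / s n := by linarith
    have hlx := Real.log_pos hx1
    have hr0 : (0 : ℝ) < ramseyNumber (s n) (k n) := lt_of_lt_of_le (by positivity) hlow
    rw [Real.rpow_def_of_pos hx0]
    nth_rewrite 1 [← Real.exp_log hr0]
    congr 1
    field_simp
    ring

theorem theorem2 :
    (∀ δ : ℝ, 0 < δ → ∃ L : ℝ, ∀ s k : ℕ, 0 < s → 0 < k → L ≤ (s : ℝ) → L * (s : ℝ) ≤ (k : ℝ) →
      ((k : ℝ) / (s : ℝ)) ^ ((1 - δ) * (s : ℝ)) ≤ (ramseyNumber s k : ℝ)) ∧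
    (∀ s k : ℕ → ℕ,
      Filter.Tendsto s Filter.atTop Filter.atTop →
      Filter.Tendsto (fun n => (k n : ℝ) / (s n : ℝ)) Filter.atTop Filter.atTop →
      ∃ ε : ℕ → ℝ, Filter.Tendsto ε Filter.atTop (nhds 0) ∧
        ∀ᶠ n in Filter.atTop,
          (ramseyNumber (s n) (k n) : ℝ) =
            ((k n : ℝ) / (s n : ℝ)) ^ ((1 + ε n) * (s n : ℝ))) := by
  refine ⟨fun δ hδ => ?_, exists_ramseyNumber_eq_rpow⟩
  obtain ⟨L, hL⟩ := exists_rpow_le_ramseyNumber hδ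
  exact ⟨L, fun s k hs _ => hL s k hs⟩
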